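/- Notation. $\mathbb{R}^n,\mathbb{R}^m$ carry the Euclidean norm, $\mathbb{B}$ is the closed unit ball, and a set-valued map $S:X\rightrightarrows Y$ has inverse $S^{-1}(y)=\{x: y\in S(x)\}$. For a set $C$ and $\bar z\in C$, $T_C(\bar z)$ is the contingent cone: all limits of $(z_i-\bar z)/\tau_i$ with $z_i\to\bar z$, $z_i\in C$, $\tau_i>0$, $\tau_i\to 0$. The set $C$ is *Clarke regular at* $\bar z\in C$ if $T_C:C\rightrightarrows\mathbb{R}^m$ is inner semicontinuous at $\bar z$: for all $\rho,\varepsilon>0$ there is a neighbourhood $V$ of $\bar z$ with $T_C(\bar z)\cap\rho\mathbb{B}\subset T_C(z)+\varepsilon\mathbb{B}$ for all $z\in C\cap V$. A map $H:\mathbb{R}^m\rightrightarrows\mathbb{R}^n$ is a *prefan* if every $H(p)$ is nonempty, convex and compact, $H$ is positively homogeneous ($H(0)$ is a cone and $H(kp)=kH(p)$ for $k>0$), and $\sup_{\|p\|\le1}\sup_{z\in H(p)}\|z\|<\infty$. For $\bar y\in S(\bar x)$, $S$ is *pseudo strictly $H$-differentiable at* $(\bar x,\bar y)$ if for every $\delta>0$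 there are neighbourhoods $U$ of $\bar x$ and $V$ of $\bar y$ such that $S(x)\cap V\subset S(x')+H(x-x')+\delta\|x-x'\|\mathbb{B}$ for all $x,x'\in U$. **Proposition (Constraint mappings).** Let $F:\mathbb{R}^n\to\mathbb{R}^m$ be continuously differentiable. (a) Let $D\subset\mathbb{R}^m$ be closed, let $S(x)=F(x)-D$, let $\bar u\in S(\bar x)$, and suppose that $D$ is Clarke regular at $F(\bar x)-\bar u$ (in particular, this holds if $D$ is Clarke regular at each of its points). Then $S^{-1}(u)=\{x: F(x)-u\in D\}$ for all $u$. If $H:\mathbb{R}^m\rightrightarrows\mathbb{R}^n$ is a prefan such that for every $p\in\mathbb{R}^m\setminus\{0\}$ there is $q\in-H(-p)$ with $\nabla F(\bar x)q-p\in T_D(F(\bar x)-\bar u)$, then $S^{-1}$ is pseudo strictly $H$-differentiable at $(\bar u,\bar x)$. (b) Let $0\le r\le m$ and $D=\{0\}^r\times\mathbb{R}_-^{m-r}$. Then $D$ is closed and Clarke regular at each of its points, and for $S(x)=F(x)-D$, $$S^{-1}(u)=\{x: F_i(x)=u_i\ (i\le r),\ F_i(x)\le u_i\ (i>r)\}\quad\text{for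 all } u.$$ Suppose that $\bar u\in S(\bar x)$ and that the Mangasarian–Fromovitz constraint qualification holds: the gradients $\nabla F_i(\bar x)$, $i\le r$, are linearly independent, and there is $w\in\mathbb{R}^n$ with $\nabla F_i(\bar x)w=0$ for all $i\le r$ and $\nabla F_i(\bar x)w<0$ for all $i>r$ with $F_i(\bar x)=\bar u_i$. Then there is $\kappa\ge0$ such that $H(p)=\kappa\|p\|\mathbb{B}$ is a prefan that satisfies the condition on $H$ in (a), and $S^{-1}$ is pseudo strictly $H$-differentiable at $(\bar u,\bar x)$ for this $H$ (so $S^{-1}$ has the Aubin property there). -/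

import Mathlib

open Set Filter Topology
open scoped Pointwise ENNReal

namespace GenDiff

noncomputable section

/-- A set-valued map `X ⇉ Y`. -/
abbrev SetMap (X Y : Type*) := X → Set Y

/-- The inverse map `y ↦ {x | y ∈ S x}`. -/
def SetMap.inv {X Y : Type*} (S : SetMap X Y) : SetMap Y X := fun y => {x | y ∈ S x}

section Normed

variable {X Y : Type*} [NormedAddCommGroup X] [NormedSpace ℝ X]
  [NormedAddCommGroup Y] [NormedSpace ℝ Y]

/-- A cone: a set that contains the origin and is stable under positive scaling. -/
def IsCone (K : Set Y) : Prop := 0 ∈ K ∧ ∀ k : ℝ, 0 < k → ∀ z ∈ K, k • z ∈ K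

/-- `H 0` is a cone and `H (k w) = k H w` for all `k > 0`. -/
def PosHomogeneous (H : SetMap X Y) : Prop :=
  IsCone (H 0) ∧ ∀ k : ℝ, 0 < k → ∀ w : X, H (k • w) = k • H w

/-- The map `(H + δ)(w) = H(w) + δ‖w‖𝔹`, where `𝔹` is the closed unit ball. -/
def enlarge (H : SetMap X Y) (δ : ℝ) : SetMap X Y :=
  fun w => H w + (δ * ‖w‖) • Metric.closedBall (0 : Y) 1

/-- `S` is pseudo strictly `H`-differentiable at the point `(x₀, y₀)` of its graph. -/
def PseudoStrictlyDiffAt (S H : SetMap X Y) (x₀ : X) (y₀ : Y) : Prop :=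
  y₀ ∈ S x₀ ∧
    ∀ δ : ℝ, 0 < δ → ∃ U ∈ 𝓝 x₀, ∃ V ∈ 𝓝 y₀,
      ∀ x ∈ U, ∀ x' ∈ U, S x ∩ V ⊆ S x' + enlarge H δ (x - x')

/-- The outer norm `sup_{‖w‖ ≤ 1} sup_{z ∈ H w} ‖z‖`, with values in `[0, ∞]`. -/
def outerNorm (H : SetMap X Y) : ℝ≥0∞ :=
  ⨆ (w : X) (_ : ‖w‖ ≤ 1) (z : Y) (_ : z ∈ H w), ‖z‖ₑ

/-- Prefans: positively homogeneous maps with nonempty convex compact values and finite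
outer norm. -/
structure IsPrefan (H : SetMap X Y) : Prop where
  nonempty : ∀ p, (H p).Nonempty
  convex : ∀ p, Convex ℝ (H p)
  isCompact : ∀ p, IsCompact (H p)
  posHomogeneous : PosHomogeneous H
  outerNorm_lt_top : outerNorm H < ⊤

/-- The contingent (Bouligand) tangent cone to `C` at `x₀ ∈ C`: the limits of
`(xᵢ - x₀) / τᵢ` with `xᵢ → x₀` in `C`, `τᵢ > 0` and `τᵢ → 0`. -/
def contingentCone (C : Set X) (x₀ : X) : Set X :=
  {w | ∃ (x : ℕ → X) (τ : ℕ → ℝ), (∀ i, x i ∈ C) ∧ Tendsto x atTop (𝓝 x₀) ∧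
    (∀ i, 0 < τ i) ∧ Tendsto τ atTop (𝓝 0) ∧
    Tendsto (fun i => (τ i)⁻¹ • (x i - x₀)) atTop (𝓝 w)}

/-- Inner semicontinuity of `T` at `x₀` with respect to `C`. -/
def InnerSemicontinuousAt (T : SetMap X Y) (C : Set X) (x₀ : X) : Prop :=
  ∀ ρ : ℝ, 0 < ρ → ∀ ε : ℝ, 0 < ε → ∃ V ∈ 𝓝 x₀, ∀ x ∈ C ∩ V,
    T x₀ ∩ Metric.closedBall 0 ρ ⊆ T x + Metric.closedBall (0 : Y) ε

/-- Clarke regularity of `C` at `x₀ ∈ C`: the tangent map `x ↦ T_C(x)`, `x ∈ C`, is inner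
semicontinuous at `x₀`. -/
def ClarkeRegularAt (C : Set X) (x₀ : X) : Prop :=
  x₀ ∈ C ∧ InnerSemicontinuousAt (contingentCone C) C x₀

/-- The constraint mapping `S(x) = F(x) - D = {F(x) - d | d ∈ D}`. -/
def constraintMap (F : X → Y) (D : Set Y) : SetMap X Y := fun x => {F x} - D

/-- For all `p ≠ 0` there is `q ∈ -H(-p)` with `∇F(x₀)q - p ∈ T_D(F(x₀) - u₀)`. -/
def TangencyCondition (F : X → Y) (D : Set Y) (H : SetMap Y X) (u₀ : Y) (x₀ : X) : Prop :=
  ∀ p : Y, p ≠ 0 → ∃ q ∈ -H (-p), fderiv ℝ F x₀ q - p ∈ contingentCone D (F x₀ - u₀)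

end Normed

/-- The set `{0}^r × ℝ₋^(m - r)` in `ℝᵐ`. -/
def mixedCone (m r : ℕ) : Set (EuclideanSpace ℝ (Fin m)) :=
  {z | ∀ i : Fin m, (i.val < r → z i = 0) ∧ (r ≤ i.val → z i ≤ 0)}

/-- The Mangasarian-Fromovitz constraint qualification at a solution `x₀` of the system
`Fᵢ(x) = uᵢ` for the first `r` indices, `Fᵢ(x) ≤ uᵢ` for the others: the derivatives of the
equality constraints are linearly independent, and some `w` is annihilated by them and is
mapped to a negative number by the derivative of every active inequality constraint. -/
def MangasarianFromovitzAt {n m : ℕ}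
    (F : EuclideanSpace ℝ (Fin n) → EuclideanSpace ℝ (Fin m)) (r : ℕ)
    (u₀ : EuclideanSpace ℝ (Fin m)) (x₀ : EuclideanSpace ℝ (Fin n)) : Prop :=
  LinearIndependent ℝ (fun i : {i : Fin m // i.val < r} =>
      (EuclideanSpace.proj (𝕜 := ℝ) i.1 : EuclideanSpace ℝ (Fin m) →L[ℝ] ℝ).comp
        (fderiv ℝ F x₀)) ∧
    ∃ w : EuclideanSpace ℝ (Fin n),
      (∀ i : Fin m, i.val < r → fderiv ℝ F x₀ w i = 0) ∧
      (∀ i : Fin m, r ≤ i.val → F x₀ i = u₀ i → fderiv ℝ F x₀ w i < 0)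

end

end GenDiff

open GenDiff

open Set Filter Topology
open scoped Pointwise

namespace GenDiff

/-! ### Contingent cones and uniform use of Clarke regularity -/

section ContingentCone

variable {X : Type*} [NormedAddCommGroup X] [NormedSpace ℝ X] {C : Set X} {z : X}

/-! Let `x` be feasible for `u`, put `p = u' - u` and take `q` from the tangency condition. Moving
`x` along `q` while the parameter moves along `p` changes `F x - u` nearly in a direction tangent to
`D` at the reference point. Clarke regularity supplies almost the same tangent direction at nearby
points of `D`, so `x + q` is feasible for some `u₁` within `ε‖p‖` of `u'`
(`exists_feasible_along_direction`). The same step with `ε ≤ 1/2` halves residuals, and a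
compactness argument then yields `x'` feasible for `u'` with `‖x' - (x + q)‖ ≤ 2Mε‖p‖`
(`exists_feasible_of_forall_exists_half`). Since `-q ∈ H(u - u')`, this is the inclusion sought. In
(b) the tangent cones are explicit, and a right inverse of the equality gradients plus a large
multiple of the MFCQ vector gives `q`. -/

theorem zero_mem_contingentCone (hz : z ∈ C) : (0 : X) ∈ contingentCone C z :=
  ⟨fun _ => z, fun i => 1 / ((i : ℝ) + 1), fun _ => hz, tendsto_const_nhds,
    fun _ => Nat.one_div_pos_of_nat, tendsto_one_div_add_atTop_nhds_zero_nat, by simp⟩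

theorem smul_mem_contingentCone {v : X} (hv : v ∈ contingentCone C z) {c : ℝ} (hc : 0 < c) :
    c • v ∈ contingentCone C z := by
  obtain ⟨x, τ, hx, hxz, hτ, hτ0, hlim⟩ := hv
  refine ⟨x, fun i => c⁻¹ * τ i, hx, hxz, fun i => mul_pos (inv_pos.2 hc) (hτ i), ?_, ?_⟩
  · simpa using hτ0.const_mul c⁻¹
  · simpa [mul_inv, mul_smul, mul_comm] using hlim.const_smul c

theorem mem_contingentCone_of_eventually {v : X} (hv : ∀ᶠ t : ℝ in 𝓝[>] 0, z + t • v ∈ C) :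
    v ∈ contingentCone C z := by
  obtain ⟨b, hb, hsub⟩ := mem_nhdsGT_iff_exists_Ioo_subset.1 hv
  have hb : 0 < b := hb
  have hlim : Tendsto (fun i : ℕ => b / 2 * (1 / ((i : ℝ) + 1))) atTop (𝓝 0) := by
    simpa using (tendsto_one_div_add_atTop_nhds_zero_nat (𝕜 := ℝ)).const_mul (b / 2)
  have hpos (i : ℕ) : 0 < b / 2 * (1 / ((i : ℝ) + 1)) := by positivity
  refine ⟨fun i => z + (b / 2 * (1 / ((i : ℝ) + 1))) • v, _, fun i => hsub ⟨hpos i, ?_⟩, ?_,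
    hpos, hlim, ?_⟩
  · have h1 : 1 / ((i : ℝ) + 1) ≤ 1 := by
      rw [div_le_one (by positivity)]
      linarith [(Nat.cast_nonneg i : (0 : ℝ) ≤ i)]
    nlinarith
  · simpa using tendsto_const_nhds.add (hlim.smul_const v)
  · refine tendsto_const_nhds.congr fun i => ?_
    rw [add_sub_cancel_left, inv_smul_smul₀ (hpos i).ne']

/-- Tangent cones are invariant under scaling, so the error becomes relative to `c`. With `c = ‖p‖`,
one neighbourhood serves all `p`. -/
theorem ClarkeRegularAt.exists_nhds_approx (h : ClarkeRegularAt C z) {ρ ε : ℝ} (hρ : 0 < ρ)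
    (hε : 0 < ε) : ∃ V ∈ 𝓝 z, ∀ y ∈ C ∩ V, ∀ c : ℝ, 0 < c → ∀ v ∈ contingentCone C z,
      ‖v‖ ≤ ρ * c → ∃ v' ∈ contingentCone C y, ‖v' - v‖ ≤ ε * c := by
  obtain ⟨V, hV, hsub⟩ := h.2 ρ hρ ε hε
  refine ⟨V, hV, fun y hy c hc v hv hvc => ?_⟩
  have hmem : c⁻¹ • v ∈ contingentCone C z ∩ Metric.closedBall 0 ρ := by
    refine ⟨smul_mem_contingentCone hv (inv_pos.2 hc), ?_⟩
    rw [mem_closedBall_zero_iff, norm_smul, Real.norm_of_nonneg (inv_pos.2 hc).le,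
      inv_mul_le_iff₀ hc, mul_comm]
    exact hvc
  obtain ⟨v', hv', e, he, hsum⟩ := hsub y hy hmem
  refine ⟨c • v', smul_mem_contingentCone hv' hc, ?_⟩
  have : c • v' - v = -(c • e) := by
    have h1 : v = c • (v' + e) := by
      rw [show v' + e = c⁻¹ • v from hsum, smul_inv_smul₀ hc.ne']
    rw [h1, smul_add]
    abel
  rw [this, norm_neg, norm_smul, Real.norm_of_nonneg hc.le, mul_comm]
  exact mul_le_mul_of_nonneg_right (mem_closedBall_zero_iff.1 he) hc.le

end ContingentCone

/-! ### Moving feasible points and differentiability of the inverse -/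

section ConstraintMap

theorem mem_constraintMap {X Y : Type*} [NormedAddCommGroup Y] {F : X → Y} {D : Set Y} {x : X} {u : Y} :
    u ∈ constraintMap F D x ↔ F x - u ∈ D := by
  simp only [constraintMap, singleton_sub, mem_image]
  exact ⟨by rintro ⟨d, hd, rfl⟩; simpa using hd, fun h => ⟨_, h, by simp⟩⟩

/-- Feasible points depend on the parameter in a Lipschitz way if, near the reference point, every
feasible point can be moved so that the distance to the target parameter is halved. -/
theorem exists_feasible_of_forall_exists_half {X Y : Type*} [NormedAddCommGroup X]
    [NormedAddCommGroup Y] [ProperSpace X] [ProperSpace Y] {G : Set (X × Y)}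
    (hG : IsClosed G) {M : ℝ} (hM : 0 < M) {x : X} {u u' : Y} (hxu : (x, u) ∈ G)
    (hstep : ∀ y v, (y, v) ∈ G → ‖y - x‖ ≤ 2 * M * ‖u' - u‖ → ‖u' - v‖ ≤ ‖u' - u‖ →
      ∃ y' v', (y', v') ∈ G ∧ ‖y' - y‖ ≤ M * ‖u' - v‖ ∧ ‖u' - v'‖ ≤ 1 / 2 * ‖u' - v‖) :
    ∃ x', (x', u') ∈ G ∧ ‖x' - x‖ ≤ 2 * M * ‖u' - u‖ := by
  -- A half step moves by at most `M` times the residual and saves `2M` times half of it, so it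
  -- stays in `K`. A point of `K` with least residual must therefore have residual zero.
  let K : Set (X × Y) := G ∩ {y | ‖y.1 - x‖ + 2 * M * ‖u' - y.2‖ ≤ 2 * M * ‖u' - u‖}
  have hbd {y : X} {v : Y} (h : ‖y - x‖ + 2 * M * ‖u' - v‖ ≤ 2 * M * ‖u' - u‖) :
      ‖y - x‖ ≤ 2 * M * ‖u' - u‖ ∧ ‖u' - v‖ ≤ ‖u' - u‖ := by
    constructor
    · have : 0 ≤ 2 * M * ‖u' - v‖ := by positivity
      linarith
    · have := norm_nonneg (y - x)
      exact le_of_mul_le_mul_left (by linarith) (by positivity : 0 < 2 * M)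
  have hK : IsCompact K := by
    refine ((isCompact_closedBall x (2 * M * ‖u' - u‖)).prod
      (isCompact_closedBall u' ‖u' - u‖)).of_isClosed_subset
      (hG.inter (isClosed_le (by fun_prop) (by fun_prop))) ?_
    rintro ⟨y, v⟩ ⟨-, h⟩
    obtain ⟨h1, h2⟩ := hbd h
    exact ⟨mem_closedBall_iff_norm.2 h1, mem_closedBall_iff_norm'.2 h2⟩
  obtain ⟨⟨y, v⟩, ⟨hyG, hy⟩, hmin⟩ := hK.exists_isMinOn
    (f := fun y : X × Y => ‖u' - y.2‖) ⟨(x, u), hxu, by simp⟩ (by fun_prop)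
  obtain ⟨h1, h2⟩ := hbd hy
  obtain ⟨y', v', hG', hy', hv'⟩ := hstep y v hyG h1 h2
  have hmem : (y', v') ∈ K := by
    refine ⟨hG', ?_⟩
    replace hy : ‖y - x‖ + 2 * M * ‖u' - v‖ ≤ 2 * M * ‖u' - u‖ := hy
    change ‖y' - x‖ + 2 * M * ‖u' - v'‖ ≤ 2 * M * ‖u' - u‖
    have h3 : ‖y' - x‖ ≤ ‖y' - y‖ + ‖y - x‖ := norm_sub_le_norm_sub_add_norm_sub _ _ _
    have h4 : M * ‖u' - v'‖ ≤ M * (1 / 2 * ‖u' - v‖) := by gcongr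
    linarith
  have h5 : ‖u' - v‖ ≤ ‖u' - v'‖ := hmin hmem
  have h6 : u' - v = 0 := norm_le_zero_iff.1 (by linarith)
  obtain rfl := sub_eq_zero.1 h6
  exact ⟨y, hyG, h1⟩

variable {X Y : Type*} [NormedAddCommGroup X] [NormedSpace ℝ X]
  [NormedAddCommGroup Y] [NormedSpace ℝ Y]

theorem exists_feasible_along_direction [ProperSpace Y] {F : X → Y} {A : X →L[ℝ] Y} {D : Set Y}
    {x₀ : X} {u₀ : Y} (hA : HasStrictFDerivAt F A x₀) (hF : Continuous F) (hD : IsClosed D)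
    (hreg : ClarkeRegularAt D (F x₀ - u₀)) {M ε : ℝ} (hM : 0 < M) (hε : 0 < ε) :
    ∃ η : ℝ, 0 < η ∧ ∀ (x : X) (u p : Y) (q : X), ‖x - x₀‖ ≤ η → ‖u - u₀‖ ≤ η → ‖p‖ ≤ η →
      F x - u ∈ D → ‖q‖ ≤ M * ‖p‖ → A q - p ∈ contingentCone D (F x₀ - u₀) →
      ∃ w : Y, F (x + q) - w ∈ D ∧ ‖w - (u + p)‖ ≤ ε * ‖p‖ := by
  -- The error has three sources: linearization (`e * M`), replacing the tangent vector (`e`), and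
  -- the difference quotient (`e`).
  obtain ⟨e, he, heM⟩ : ∃ e : ℝ, 0 < e ∧ e * (M + 2) = ε :=
    ⟨ε / (M + 2), by positivity, div_mul_cancel₀ _ (by positivity)⟩
  obtain ⟨V, hV, happrox⟩ :=
    hreg.exists_nhds_approx (ρ := ‖A‖ * M + 1) (by positivity) he
  have hc : Tendsto (fun y : X × Y => F y.1 - y.2) (𝓝 (x₀, u₀)) (𝓝 (F x₀ - u₀)) :=
    ((hF.comp continuous_fst).sub continuous_snd).tendsto (x₀, u₀)
  obtain ⟨r₁, hr₁, hV'⟩ := Metric.eventually_nhds_iff.1 (hc hV)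
  obtain ⟨r₂, hr₂, hstrict⟩ := Metric.eventually_nhds_iff.1 (hA.isLittleO.def he)
  obtain ⟨η, hη, hηr⟩ : ∃ η : ℝ, 0 < η ∧ η * (3 + M + ε) < min r₁ r₂ := by
    refine ⟨min r₁ r₂ / 2 / (3 + M + ε), by positivity, ?_⟩
    rw [div_mul_cancel₀ _ (by positivity)]
    linarith [lt_min hr₁ hr₂]
  refine ⟨η, hη, fun x u p q hx hu hp hxu hq hqp => ?_⟩
  rcases eq_or_ne p 0 with rfl | hp0
  · obtain rfl : q = 0 := by simpa using hq
    exact ⟨u, by simpa using hxu, by simp⟩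
  have hp0 : 0 < ‖p‖ := norm_pos_iff.2 hp0
  -- The fractions `s` of the move attainable with error proportional to `s`. A largest one exists
  -- by compactness, and if it were below `1` a tangent direction at that point would extend it.
  let K : Set (ℝ × Y) := {y | y.1 ∈ Icc (0 : ℝ) 1 ∧ F (x + y.1 • q) - y.2 ∈ D ∧
    ‖y.2 - (u + y.1 • p)‖ ≤ ε * y.1 * ‖p‖}
  have hKc : IsCompact K := by
    refine ((isCompact_Icc (a := (0 : ℝ)) (b := 1)).prod
      (isCompact_closedBall u ((1 + ε) * ‖p‖))).of_isClosed_subset ?_ ?_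
    · refine (isClosed_Icc.preimage continuous_fst).inter
        ((hD.preimage (f := fun y : ℝ × Y => F (x + y.1 • q) - y.2) (by fun_prop)).inter
          (isClosed_le (f := fun y : ℝ × Y => ‖y.2 - (u + y.1 • p)‖)
            (g := fun y : ℝ × Y => ε * y.1 * ‖p‖) (by fun_prop) (by fun_prop)))
    · rintro ⟨s, w⟩ ⟨hs, -, hw⟩
      refine ⟨hs, ?_⟩
      simp only [mem_closedBall_iff_norm] at hw ⊢
      have h1 : ‖w - u‖ ≤ ‖w - (u + s • p)‖ + ‖s • p‖ := by
        simpa [sub_add_eq_sub_sub] using norm_add_le (w - (u + s • p)) (s • p)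
      rw [norm_smul, Real.norm_of_nonneg hs.1] at h1
      have h2 : (1 + ε) * s * ‖p‖ ≤ (1 + ε) * 1 * ‖p‖ := by gcongr; exact hs.2
      linarith
  have hK0 : ((0 : ℝ), u) ∈ K := ⟨by simp, by simpa using hxu, by simp⟩
  obtain ⟨⟨s, w⟩, ⟨hs, hsD, hsw⟩, hmax⟩ := hKc.exists_isMaxOn ⟨_, hK0⟩ continuous_fst.continuousOn
  dsimp only at hs hsD hsw
  rcases hs.2.eq_or_lt with rfl | hs1
  · exact ⟨w, by simpa using hsD, by simpa using hsw⟩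
  exfalso
  -- Points `x + t q` and values near the segment stay in the neighbourhoods of `x₀` and `u₀`.
  have hnear (t : ℝ) (ht : t ∈ Icc (0 : ℝ) 1) : ‖x + t • q - x₀‖ < min r₁ r₂ := by
    have h1 : ‖x + t • q - x₀‖ ≤ ‖x - x₀‖ + ‖t • q‖ := by
      rw [show x + t • q - x₀ = (x - x₀) + t • q by abel]
      exact norm_add_le _ _
    rw [norm_smul, Real.norm_of_nonneg ht.1] at h1
    have h2 : t * ‖q‖ ≤ 1 * (M * η) := by
      gcongr
      · exact ht.2
      · exact hq.trans (by gcongr)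
    nlinarith [mul_pos hη hε]
  have hw : ‖w - u₀‖ < min r₁ r₂ := by
    have h1 : ‖w - u₀‖ ≤ ‖w - (u + s • p)‖ + ‖u - u₀‖ + ‖s • p‖ := by
      rw [show w - u₀ = (w - (u + s • p)) + (u - u₀) + s • p by abel]
      exact norm_add₃_le
    rw [norm_smul, Real.norm_of_nonneg hs.1] at h1
    have h2 : s * ‖p‖ ≤ 1 * η := by gcongr
    have h3 : ε * (s * ‖p‖) ≤ ε * (1 * η) := by gcongr
    nlinarith [mul_pos hη hM]
  set z : Y := F (x + s • q) - w with hz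
  have hzV : z ∈ V := by
    refine hV' (y := (x + s • q, w)) ?_
    rw [Prod.dist_eq, max_lt_iff, dist_eq_norm, dist_eq_norm]
    exact ⟨(hnear s hs).trans_le (min_le_left _ _), hw.trans_le (min_le_left _ _)⟩
  have hbound : ‖A q - p‖ ≤ (‖A‖ * M + 1) * ‖p‖ := by
    have h1 : ‖A q‖ ≤ ‖A‖ * (M * ‖p‖) := (A.le_opNorm q).trans (by gcongr)
    linarith [norm_sub_le (A q) p]
  obtain ⟨v, ⟨d, τ, hdD, -, hτ, hτ0, hlim⟩, hv⟩ :=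
    happrox z ⟨hsD, hzV⟩ ‖p‖ hp0 _ hqp hbound
  have hev1 := hτ0.eventually_lt_const (sub_pos.2 hs1)
  have hev2 := hlim.eventually (Metric.closedBall_mem_nhds v (mul_pos he hp0))
  obtain ⟨i, hi1, hi2⟩ := (hev1.and hev2).exists
  rw [dist_eq_norm] at hi2
  have hti := hτ i
  -- The parameter is chosen so that the new constraint value is exactly `d i ∈ D`.
  have hmem : (s + τ i, F (x + (s + τ i) • q) - d i) ∈ K := by
    have hs' : s + τ i ∈ Icc (0 : ℝ) 1 := ⟨by linarith [hs.1], by linarith⟩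
    refine ⟨hs', by simpa using hdD i, ?_⟩
    have hst := hstrict (y := (x + (s + τ i) • q, x + s • q)) (by
      rw [Prod.dist_eq, max_lt_iff, dist_eq_norm, dist_eq_norm]
      exact ⟨(hnear _ hs').trans_le (min_le_right _ _), (hnear _ hs).trans_le (min_le_right _ _)⟩)
    dsimp only at hst ⊢
    have hdiff : x + (s + τ i) • q - (x + s • q) = τ i • q := by rw [add_smul]; abel
    rw [hdiff, norm_smul, Real.norm_of_nonneg hti.le, map_smul] at hst
    have hsplit : F (x + (s + τ i) • q) - d i - (u + (s + τ i) • p) =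
        (w - (u + s • p)) + (F (x + (s + τ i) • q) - F (x + s • q) - τ i • A q)
        - τ i • (v - (A q - p)) - τ i • ((τ i)⁻¹ • (d i - z) - v) := by
      simp only [smul_sub, add_smul, smul_inv_smul₀ hti.ne', hz]
      abel
    have hb : ‖F (x + (s + τ i) • q) - d i - (u + (s + τ i) • p)‖ ≤ ‖w - (u + s • p)‖ +
        ‖F (x + (s + τ i) • q) - F (x + s • q) - τ i • A q‖ + τ i * ‖v - (A q - p)‖ +
        τ i * ‖(τ i)⁻¹ • (d i - z) - v‖ := by
      rw [hsplit]
      have n1 (y : Y) : ‖τ i • y‖ = τ i * ‖y‖ := by rw [norm_smul, Real.norm_of_nonneg hti.le]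
      rw [← n1, ← n1]
      exact (norm_sub_le _ _).trans (add_le_add_left ((norm_sub_le _ _).trans
        (add_le_add_left (norm_add_le _ _) _)) _)
    have h1 : e * (τ i * ‖q‖) ≤ e * (τ i * (M * ‖p‖)) := by gcongr
    have h2 : τ i * ‖v - (A q - p)‖ ≤ τ i * (e * ‖p‖) := by gcongr
    have h3 : τ i * ‖(τ i)⁻¹ • (d i - z) - v‖ ≤ τ i * (e * ‖p‖) := by gcongr
    have h4 : ε * (s + τ i) * ‖p‖ = ε * s * ‖p‖ + e * (τ i * (M * ‖p‖)) + τ i * (e * ‖p‖)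
        + τ i * (e * ‖p‖) := by rw [← heM]; ring
    linarith
  have := hmax hmem
  simp only [mem_ofPred_eq] at this
  linarith

theorem IsPrefan.exists_norm_le {H : SetMap X Y} (hH : IsPrefan H) :
    ∃ M : ℝ, 0 < M ∧ ∀ p, ∀ z ∈ H p, ‖z‖ ≤ M * ‖p‖ := by
  have hunit (p : X) (hp : ‖p‖ ≤ 1) (z : Y) (hz : z ∈ H p) : ‖z‖ ≤ (outerNorm H).toReal := by
    have h1 : ‖z‖ₑ ≤ outerNorm H :=
      le_iSup_of_le p <| le_iSup_of_le hp <| le_iSup_of_le z <| le_iSup_of_le hz le_rfl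
    simpa using ENNReal.toReal_mono hH.outerNorm_lt_top.ne h1
  refine ⟨(outerNorm H).toReal + 1, by positivity, fun p z hz => ?_⟩
  rcases eq_or_ne p 0 with rfl | hp
  -- A bounded cone is trivial: a nonzero `z ∈ H 0` could be scaled past the bound.
  · by_contra! hlt
    have hz0 : 0 < ‖z‖ := by simpa using hlt
    have := hunit 0 (by simp) _
      (hH.posHomogeneous.1.2 (((outerNorm H).toReal + 1) / ‖z‖) (by positivity) z hz)
    rw [norm_smul, Real.norm_of_nonneg (by positivity), div_mul_cancel₀ _ hz0.ne'] at this
    linarith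
  · have hp : 0 < ‖p‖ := norm_pos_iff.2 hp
    have hmem : ‖p‖⁻¹ • z ∈ H (‖p‖⁻¹ • p) := by
      rw [hH.posHomogeneous.2 _ (inv_pos.2 hp)]
      exact smul_mem_smul_set hz
    have h1 := hunit _ (by rw [norm_smul, norm_inv, norm_norm, inv_mul_cancel₀ hp.ne']) _ hmem
    rw [norm_smul, norm_inv, norm_norm, inv_mul_le_iff₀ hp] at h1
    linarith

theorem pseudoStrictlyDiffAt_inv_constraintMap [ProperSpace X] [ProperSpace Y] {F : X → Y}
    {D : Set Y} {x₀ : X} {u₀ : Y} (hA : HasStrictFDerivAt F (fderiv ℝ F x₀) x₀)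
    (hF : Continuous F) (hD : IsClosed D) (hreg : ClarkeRegularAt D (F x₀ - u₀))
    {H : SetMap Y X} (hH : IsPrefan H) (hT : TangencyCondition F D H u₀ x₀) :
    PseudoStrictlyDiffAt (constraintMap F D).inv H u₀ x₀ := by
  refine ⟨mem_constraintMap.2 hreg.1, fun δ hδ => ?_⟩
  obtain ⟨M, hM, hHM⟩ := hH.exists_norm_le
  have hT' (p : Y) : ∃ q, -q ∈ H (-p) ∧ ‖q‖ ≤ M * ‖p‖ ∧
      fderiv ℝ F x₀ q - p ∈ contingentCone D (F x₀ - u₀) := by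
    rcases eq_or_ne p 0 with rfl | hp
    · exact ⟨0, by simpa using hH.posHomogeneous.1.1, by simp,
        by simpa using zero_mem_contingentCone hreg.1⟩
    · obtain ⟨q, hq, hqT⟩ := hT p hp
      exact ⟨q, hq, by simpa using hHM _ _ hq, hqT⟩
  -- `1 / 2` serves the halving step, `2 * M * ε ≤ δ` the final error.
  obtain ⟨ε, hε, hε2, hεδ⟩ : ∃ ε : ℝ, 0 < ε ∧ ε ≤ 1 / 2 ∧ 2 * M * ε ≤ δ := by
    refine ⟨min (1 / 2) (δ / (2 * M)), by positivity, min_le_left _ _, ?_⟩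
    rw [mul_comm, ← le_div_iff₀ (by positivity)]
    exact min_le_right _ _
  obtain ⟨η, hη, hstep⟩ := exists_feasible_along_direction hA hF hD hreg hM hε
  -- Small enough that all corrected points, at most `(1 + 4M)θ` from `x₀`, stay within `η`.
  obtain ⟨θ, hθ, hθη⟩ : ∃ θ : ℝ, 0 < θ ∧ θ * (5 + 4 * M) = η :=
    ⟨η / (5 + 4 * M), by positivity, div_mul_cancel₀ _ (by positivity)⟩
  refine ⟨Metric.closedBall u₀ θ, Metric.closedBall_mem_nhds _ hθ, Metric.closedBall x₀ θ,
    Metric.closedBall_mem_nhds _ hθ, ?_⟩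
  rintro u hu u' hu' x ⟨hxu, hx⟩
  rw [mem_closedBall_iff_norm] at hu hu' hx
  replace hxu : F x - u ∈ D := mem_constraintMap.1 hxu
  have hMθ : 0 < M * θ := mul_pos hM hθ
  have hpθ : ‖u' - u‖ ≤ 2 * θ := by
    have := norm_sub_le_norm_sub_add_norm_sub u' u₀ u
    rw [norm_sub_rev u₀ u] at this
    linarith
  obtain ⟨q, hqH, hqM, hqT⟩ := hT' (u' - u)
  obtain ⟨u₁, hu₁D, hu₁⟩ := hstep x u (u' - u) q (by linarith) (by linarith) (by linarith)
    hxu hqM hqT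
  have hu₁' : ‖u' - u₁‖ ≤ ε * ‖u' - u‖ := by
    rw [add_sub_cancel] at hu₁
    rwa [norm_sub_rev]
  have hqθ : M * ‖u' - u‖ ≤ M * (2 * θ) := by gcongr
  have hu₁θ : ‖u' - u₁‖ ≤ 1 / 2 * (2 * θ) := hu₁'.trans (by gcongr)
  obtain ⟨x', hx', hxx'⟩ : ∃ x', (x', u') ∈ {y : X × Y | F y.1 - y.2 ∈ D} ∧
      ‖x' - (x + q)‖ ≤ 2 * M * ‖u' - u₁‖ := by
    refine exists_feasible_of_forall_exists_half (hD.preimage (by fun_prop)) hM hu₁D ?_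
    intro y v hyv hy hv
    obtain ⟨q', -, hq'M, hq'T⟩ := hT' (u' - v)
    have h1 : ‖y - x₀‖ ≤ η := by
      have h2 : ‖y - x₀‖ ≤ ‖y - (x + q)‖ + ‖x - x₀‖ + ‖q‖ := by
        rw [show y - x₀ = (y - (x + q)) + (x - x₀) + q by abel]
        exact norm_add₃_le
      have h3 : M * ‖u' - u₁‖ ≤ M * (1 / 2 * (2 * θ)) := by gcongr
      linarith
    have h4 : ‖v - u₀‖ ≤ η := by
      have h5 := norm_sub_le_norm_sub_add_norm_sub v u' u₀
      rw [norm_sub_rev v u'] at h5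
      linarith
    obtain ⟨w, hwD, hw⟩ := hstep y v (u' - v) q' h1 h4 (by linarith) hyv hq'M hq'T
    refine ⟨y + q', w, hwD, by simpa using hq'M, ?_⟩
    rw [add_sub_cancel, norm_sub_rev] at hw
    exact hw.trans (by gcongr)
  refine ⟨x', mem_constraintMap.2 hx', x - x', ?_, by simp⟩
  rw [neg_sub] at hqH
  refine ⟨-q, hqH, x - x' + q, ?_, by simp⟩
  rw [smul_unitClosedBall_of_nonneg (by positivity), mem_closedBall_zero_iff,
    show x - x' + q = -(x' - (x + q)) by abel, norm_neg, norm_sub_rev u u']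
  calc ‖x' - (x + q)‖ ≤ 2 * M * ‖u' - u₁‖ := hxx'
    _ ≤ 2 * M * (ε * ‖u' - u‖) := by gcongr
    _ = 2 * M * ε * ‖u' - u‖ := by ring
    _ ≤ δ * ‖u' - u‖ := by gcongr

end ConstraintMap

section Ball

variable {X Y : Type*} [NormedAddCommGroup X] [NormedSpace ℝ X]
  [NormedAddCommGroup Y] [NormedSpace ℝ Y]

theorem isPrefan_smul_unitClosedBall [ProperSpace Y] {κ : ℝ} (hκ : 0 ≤ κ) :
    IsPrefan (fun w : X => (κ * ‖w‖) • Metric.closedBall (0 : Y) 1) where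
  nonempty p := (Metric.nonempty_closedBall.2 zero_le_one).smul_set
  convex p := (convex_closedBall _ _).smul _
  isCompact p := (isCompact_closedBall _ _).smul _
  posHomogeneous := by
    refine ⟨⟨⟨0, by simp, by simp⟩, ?_⟩, fun k hk w => ?_⟩
    · rintro k - z ⟨y, -, rfl⟩
      exact ⟨0, by simp, by simp⟩
    · simp only [smul_smul, norm_smul, Real.norm_of_nonneg hk.le, mul_left_comm]
  outerNorm_lt_top := by
    refine lt_of_le_of_lt ?_ (ENNReal.ofReal_lt_top (r := κ))
    refine iSup_le fun w => iSup_le fun hw => iSup_le fun z => iSup_le fun hz => ?_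
    dsimp only at hz
    rw [smul_unitClosedBall_of_nonneg (by positivity), mem_closedBall_zero_iff] at hz
    rw [← ofReal_norm]
    exact ENNReal.ofReal_le_ofReal (hz.trans (mul_le_of_le_one_right hκ hw))

end Ball

/-! ### Tangent cones and regularity of `mixedCone` -/

section MixedCone

variable {m r : ℕ}

theorem isClosed_mixedCone : IsClosed (mixedCone m r) := by
  simp only [mixedCone, ofPred_forall, ofPred_and]
  refine isClosed_iInter fun i => IsClosed.inter ?_ ?_
  · exact isClosed_iInter fun _ => isClosed_eq (by fun_prop) continuous_const
  · exact isClosed_iInter fun _ => isClosed_le (by fun_prop) continuous_const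

theorem mem_contingentCone_mixedCone {z : EuclideanSpace ℝ (Fin m)} (hz : z ∈ mixedCone m r)
    {v : EuclideanSpace ℝ (Fin m)} :
    v ∈ contingentCone (mixedCone m r) z ↔
      ∀ i : Fin m, (i.val < r → v i = 0) ∧ (r ≤ i.val → z i = 0 → v i ≤ 0) := by
  constructor
  · rintro ⟨x, τ, hx, -, hτ, -, hlim⟩ i
    have hi : Tendsto (fun k => (τ k)⁻¹ * (x k i - z i)) atTop (𝓝 (v i)) := by
      have hc : Continuous fun y : EuclideanSpace ℝ (Fin m) => y i := by fun_prop
      exact (hc.tendsto v).comp hlim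
    refine ⟨fun hir => ?_, fun hir hzi => ?_⟩
    · refine tendsto_nhds_unique hi (tendsto_const_nhds.congr fun k => ?_)
      simp [(hx k i).1 hir, (hz i).1 hir]
    · refine le_of_tendsto' hi fun k => ?_
      rw [hzi, sub_zero]
      exact mul_nonpos_of_nonneg_of_nonpos (inv_pos.2 (hτ k)).le ((hx k i).2 hir)
  · intro hv
    refine mem_contingentCone_of_eventually (eventually_all.2 fun i => ?_)
    rcases lt_or_ge i.val r with hir | hir
    · refine Eventually.of_forall fun t => ⟨fun _ => ?_, fun h => absurd hir h.not_gt⟩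
      simp [(hz i).1 hir, (hv i).1 hir]
    · rcases ((hz i).2 hir).eq_or_lt with hzi | hzi
      · filter_upwards [self_mem_nhdsWithin] with t ht
        refine ⟨fun h => absurd hir h.not_ge, fun _ => ?_⟩
        simpa [hzi] using mul_nonpos_of_nonneg_of_nonpos (le_of_lt ht) ((hv i).2 hir hzi)
      · have hlim : Tendsto (fun t : ℝ => z i + t * v i) (𝓝[>] 0) (𝓝 (z i)) :=
          tendsto_nhdsWithin_of_tendsto_nhds
            (by simpa using ((by fun_prop : Continuous fun t : ℝ => z i + t * v i).tendsto 0))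
        filter_upwards [hlim.eventually_lt_const hzi] with t ht
        exact ⟨fun h => absurd hir h.not_ge, fun _ => by simpa using ht.le⟩

/-- Inactive inequalities stay inactive nearby, so the tangent cone at nearby points of the set can
only grow. -/
theorem clarkeRegularAt_mixedCone {z : EuclideanSpace ℝ (Fin m)} (hz : z ∈ mixedCone m r) :
    ClarkeRegularAt (mixedCone m r) z := by
  refine ⟨hz, fun ρ _ ε hε => ?_⟩
  have hV : ∀ᶠ y in 𝓝 z, ∀ i : Fin m, z i < 0 → y i < 0 := by
    refine eventually_all.2 fun i => ?_
    by_cases hi : z i < 0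
    · have hc : Continuous fun y : EuclideanSpace ℝ (Fin m) => y i := by fun_prop
      filter_upwards [hc.continuousAt.eventually_lt_const hi] with y hy _ using hy
    · exact Eventually.of_forall fun y h => absurd h hi
  refine ⟨_, hV, fun y hy v hv => ⟨v, ?_, 0, by simpa using hε.le, by simp⟩⟩
  rw [mem_contingentCone_mixedCone hy.1]
  have hv := (mem_contingentCone_mixedCone hz).1 hv.1
  refine fun i => ⟨(hv i).1, fun hir hyi => (hv i).2 hir ?_⟩
  by_contra hzi
  exact (hy.2 i (((hz i).2 hir).lt_of_ne hzi)).ne hyi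

end MixedCone

/-! ### Consequences of the constraint qualification -/

/-- Linearly independent functionals take arbitrary prescribed values simultaneously. -/
theorem surjective_pi_of_linearIndependent {ι E : Type*} [Finite ι] [AddCommGroup E] [Module ℝ E]
    {f : ι → E →ₗ[ℝ] ℝ} (hf : LinearIndependent ℝ f) : Function.Surjective (LinearMap.pi f) := by
  have := Fintype.ofFinite ι
  classical
  rw [← LinearMap.range_eq_top]
  by_contra hne
  -- A nonzero functional vanishing on the range would be a linear relation among the `f i`.
  obtain ⟨g, hg0, hg⟩ := Submodule.exists_le_ker_of_lt_top _ (lt_top_iff_ne_top.2 hne)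
  refine hg0 (LinearMap.pi_ext' fun i => LinearMap.ext_ring ?_)
  have hsum : ∑ i, g (Pi.single i 1) • f i = 0 := by
    ext x
    have h1 : g (LinearMap.pi f x) = 0 := hg ⟨x, rfl⟩
    rw [LinearMap.pi_apply_eq_sum_univ] at h1
    have h2 (i : ι) : (fun j => if i = j then (1 : ℝ) else 0) = Pi.single i 1 := by
      ext j
      simp [Pi.single_apply, eq_comm]
    simpa [mul_comm, h2] using h1
  simpa using Fintype.linearIndependent_iff.1 hf _ hsum i

/-- Take `q = L p + t‖p‖w`: `L p` solves the equalities, which `w` does not disturb, and a large `t`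
makes `w` outweigh `A (L p) - p` in the active inequalities. -/
theorem MangasarianFromovitzAt.exists_norm_le {n m r : ℕ}
    {F : EuclideanSpace ℝ (Fin n) → EuclideanSpace ℝ (Fin m)} {u₀ : EuclideanSpace ℝ (Fin m)}
    {x₀ : EuclideanSpace ℝ (Fin n)} (h : MangasarianFromovitzAt F r u₀ x₀)
    (hx₀ : F x₀ - u₀ ∈ mixedCone m r) :
    ∃ κ : ℝ, 0 ≤ κ ∧ ∀ p, ∃ q, ‖q‖ ≤ κ * ‖p‖ ∧
      fderiv ℝ F x₀ q - p ∈ contingentCone (mixedCone m r) (F x₀ - u₀) := by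
  obtain ⟨hli, w, hw0, hwneg⟩ := h
  set A := fderiv ℝ F x₀
  obtain ⟨B, hB⟩ := LinearMap.exists_rightInverse_of_surjective _
    (LinearMap.range_eq_top.2 (surjective_pi_of_linearIndependent
      (hli.map' (ContinuousLinearMap.coeLM ℝ) (LinearMap.ker_eq_bot.2
        ContinuousLinearMap.coe_injective))))
  let R : EuclideanSpace ℝ (Fin m) →ₗ[ℝ] ({i : Fin m // i.val < r} → ℝ) :=
    LinearMap.pi fun i => (EuclideanSpace.proj (𝕜 := ℝ) i.1).toLinearMap
  let L : EuclideanSpace ℝ (Fin m) →L[ℝ] EuclideanSpace ℝ (Fin n) :=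
    LinearMap.toContinuousLinearMap (B ∘ₗ R)
  have hL (p : EuclideanSpace ℝ (Fin m)) (i : Fin m) (hi : i.val < r) : A (L p) i = p i :=
    congrFun (LinearMap.congr_fun hB (R p)) ⟨i, hi⟩
  obtain ⟨t, ht0, ht⟩ : ∃ t : ℝ, 0 ≤ t ∧ ∀ i : Fin m, r ≤ i.val → F x₀ i = u₀ i →
      ‖A‖ * ‖L‖ + 1 ≤ t * -(A w i) := by
    have hev : ∀ᶠ t : ℝ in atTop, ∀ i : Fin m, r ≤ i.val → F x₀ i = u₀ i →
        ‖A‖ * ‖L‖ + 1 ≤ t * -(A w i) := by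
      refine eventually_all.2 fun i => ?_
      by_cases hi : r ≤ i.val ∧ F x₀ i = u₀ i
      · filter_upwards [(tendsto_id.atTop_mul_const
          (neg_pos.2 (hwneg i hi.1 hi.2))).eventually_ge_atTop (‖A‖ * ‖L‖ + 1)] with t ht _ _
        exact ht
      · exact Eventually.of_forall fun t h1 h2 => absurd ⟨h1, h2⟩ hi
    exact ((eventually_ge_atTop 0).and hev).exists
  refine ⟨‖L‖ + t * ‖w‖, by positivity, fun p => ⟨L p + (t * ‖p‖) • w, ?_, ?_⟩⟩
  · refine (norm_add_le _ _).trans ?_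
    rw [norm_smul, Real.norm_of_nonneg (by positivity)]
    linarith [L.le_opNorm p]
  · rw [mem_contingentCone_mixedCone hx₀]
    refine fun i => ⟨fun hi => by simp [hL p i hi, hw0 i hi], fun hi hact => ?_⟩
    have hact : F x₀ i = u₀ i := sub_eq_zero.1 (by simpa using hact)
    have h1 : A (L p) i ≤ ‖A‖ * ‖L‖ * ‖p‖ :=
      (le_abs_self _).trans <| (PiLp.norm_apply_le (A (L p)) i).trans <|
        (A.le_opNorm _).trans <| by
          rw [mul_assoc]
          gcongr
          exact L.le_opNorm p
    have h2 : -p i ≤ ‖p‖ := (neg_le_abs _).trans (PiLp.norm_apply_le p i)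
    have h3 := mul_le_mul_of_nonneg_right (ht i hi hact) (norm_nonneg p)
    simp only [map_add, map_smul, PiLp.sub_apply, PiLp.add_apply, PiLp.smul_apply, smul_eq_mul]
    linarith

end GenDiff

theorem proposition6p1 {n m : ℕ}
    (F : EuclideanSpace ℝ (Fin n) → EuclideanSpace ℝ (Fin m)) (hF : ContDiff ℝ 1 F)
    (u₀ : EuclideanSpace ℝ (Fin m)) (x₀ : EuclideanSpace ℝ (Fin n)) :
    -- the general result
    (∀ D : Set (EuclideanSpace ℝ (Fin m)), IsClosed D →
      u₀ ∈ constraintMap F D x₀ → ClarkeRegularAt D (F x₀ - u₀) →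
      (∀ u, (constraintMap F D).inv u = {x | F x - u ∈ D}) ∧
      ∀ H : SetMap (EuclideanSpace ℝ (Fin m)) (EuclideanSpace ℝ (Fin n)),
        IsPrefan H → TangencyCondition F D H u₀ x₀ →
        PseudoStrictlyDiffAt (constraintMap F D).inv H u₀ x₀) ∧
    -- mixed equality and inequality systems
    (∀ r ≤ m,
      IsClosed (mixedCone m r) ∧ (∀ z ∈ mixedCone m r, ClarkeRegularAt (mixedCone m r) z) ∧
      (∀ u, (constraintMap F (mixedCone m r)).inv u =
        {x | (∀ i : Fin m, i.val < r → F x i = u i) ∧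
          (∀ i : Fin m, r ≤ i.val → F x i ≤ u i)}) ∧
      (u₀ ∈ constraintMap F (mixedCone m r) x₀ → MangasarianFromovitzAt F r u₀ x₀ →
        ∃ κ : ℝ, 0 ≤ κ ∧ ∃ H : SetMap (EuclideanSpace ℝ (Fin m)) (EuclideanSpace ℝ (Fin n)),
          (∀ w, H w = (κ * ‖w‖) • Metric.closedBall (0 : EuclideanSpace ℝ (Fin n)) 1) ∧
          IsPrefan H ∧ TangencyCondition F (mixedCone m r) H u₀ x₀ ∧
          PseudoStrictlyDiffAt (constraintMap F (mixedCone m r)).inv H u₀ x₀)) := by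
  have hA : HasStrictFDerivAt F (fderiv ℝ F x₀) x₀ :=
    hF.contDiffAt.hasStrictFDerivAt one_ne_zero
  refine ⟨fun D hD _ hreg => ⟨fun u => Set.ext fun x => mem_constraintMap, fun H hH hT =>
    pseudoStrictlyDiffAt_inv_constraintMap hA hF.continuous hD hreg hH hT⟩, fun r _ =>
    ⟨isClosed_mixedCone, fun z hz => clarkeRegularAt_mixedCone hz, fun u => ?_, fun hu hMF => ?_⟩⟩
  · ext x
    refine mem_constraintMap.trans ?_
    simp only [mixedCone, Set.mem_ofPred_eq, PiLp.sub_apply, sub_eq_zero, sub_nonpos, forall_and]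
  · have hx₀ := mem_constraintMap.1 hu
    obtain ⟨κ, hκ, hq⟩ := hMF.exists_norm_le hx₀
    have hT : TangencyCondition F (mixedCone m r)
        (fun w => (κ * ‖w‖) • Metric.closedBall (0 : EuclideanSpace ℝ (Fin n)) 1) u₀ x₀ := by
      intro p _
      obtain ⟨q, hqp, hqT⟩ := hq p
      refine ⟨q, ?_, hqT⟩
      rw [Set.mem_neg]
      dsimp only
      rw [smul_unitClosedBall_of_nonneg (by positivity), mem_closedBall_zero_iff]
      simpa using hqp
    have hH := isPrefan_smul_unitClosedBall (X := EuclideanSpace ℝ (Fin m))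
      (Y := EuclideanSpace ℝ (Fin n)) hκ
    exact ⟨κ, hκ, _, fun _ => rfl, hH, hT, pseudoStrictlyDiffAt_inv_constraintMap hA hF.continuous
      isClosed_mixedCone (clarkeRegularAt_mixedCone hx₀) hH hT⟩
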